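/- Let $R>0$, let $\Psi=\{z\in\mathbb C:\ |\operatorname{Im} z|\le R\}$, and let $(a_{m,n})_{m,n\in\mathbb Z_+}$ be a family of complex numbers, where $\mathbb Z_+=\{0,1,2,\dots\}$. For $m,n\in\mathbb Z_+$ set $$s_{m,n}=\frac{1}{2^m(2i)^n}\sum_{k=0}^m\sum_{j=0}^n(-1)^{n-j}\binom mk\binom nj\,a_{k+j,\,m-k+n-j}.$$ There exists a non-negative Borel measure $\sigma$ on $\Psi$ such that, for all $m,n\in\mathbb Z_+$, the function $z^m\overline z^{\,n}$ is $\sigma$-integrable and $$\int_\Psi z^m\overline z^{\,n}\,d\sigma=a_{m,n},$$ if and only if the following three conditions hold: 1. for all complex numbers $\alpha_{m,n}$ ($m,n\in\mathbb Z_+$), all but finitely many of which are zero, $$\sum_{m,n,k,l=0}^\infty\alpha_{m,n}\overline{\alpha_{k,l}}\,s_{m+k,n+l}\ge 0;$$ 2. for all complex numbers $\alpha_{m,n}$ ($m,n\in\mathbb Z_+$), all but finitely many of which are zero, $$\sum_{m,n,k,l=0}^\infty\alpha_{m,n}\overline{\alpha_{k,l}}\,\bigl(R^2s_{m+k,n+l}-s_{m+k,n+l+2}\bigr)\ge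 0;$$ 3. for all $m,n\in\mathbb Z_+$, $$a_{m,n}=\sum_{r=0}^m\sum_{l=0}^n\binom mr\binom nl(-1)^{n-l}\,i^{\,m-r+n-l}\,s_{r+l,\,m-r+n-l}.$$ Here "$\ge 0$" for a complex number means that it is real and non-negative. -/

import Mathlib

open scoped ComplexOrder

namespace StripMoment

/-- The closed strip `Ψ(R) = {z ∈ ℂ : |Im z| ≤ R}`. -/
def strip (R : ℝ) : Set ℂ := {z | |z.im| ≤ R}

/-- `σ` is a non-negative Borel measure carried by the strip `Ψ(R)`, for which all the monomials
`z ^ m * conj z ^ n` are integrable and have the prescribed integrals `a m n`. -/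
structure IsSolution (R : ℝ) (a : ℕ → ℕ → ℂ) (σ : MeasureTheory.Measure ℂ) : Prop where
  carried : σ (strip R)ᶜ = 0
  integrable : ∀ m n : ℕ, MeasureTheory.IntegrableOn
    (fun z : ℂ => z ^ m * (starRingEnd ℂ z) ^ n) (strip R) σ
  moment : ∀ m n : ℕ, ∫ z in strip R, z ^ m * (starRingEnd ℂ z) ^ n ∂σ = a m n

/-- The complex moment problem in the strip `Ψ(R)` with data `a` has a solution. -/
def Solvable (R : ℝ) (a : ℕ → ℕ → ℂ) : Prop :=
  ∃ σ : MeasureTheory.Measure ℂ, IsSolution R a σ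

/-- The numbers `s m n` computed from the complex moments `a`: the formal moments of
`((z + conj z) / 2) ^ m * ((z - conj z) / (2 i)) ^ n`. In the sum `k ≤ m` and `j ≤ n`, so that
the subtractions are exact. -/
noncomputable def realMoment (a : ℕ → ℕ → ℂ) (m n : ℕ) : ℂ :=
  1 / (2 ^ m * (2 * Complex.I) ^ n) *
    ∑ k ∈ Finset.range (m + 1), ∑ j ∈ Finset.range (n + 1),
      (-1) ^ (n - j) * (m.choose k : ℂ) * (n.choose j : ℂ) * a (k + j) ((m - k) + (n - j))

/-- The kernel `((m, n), (k, l)) ↦ t (m + k) (n + l)` is positive definite: for each finitely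
supported complex family `α`, the sum of `α (m,n) * conj (α (k,l)) * t (m + k) (n + l)` is `≥ 0`
(a complex number is `≥ 0` if it is real and nonnegative). -/
def PosKernel (t : ℕ → ℕ → ℂ) : Prop :=
  ∀ α : ℕ × ℕ →₀ ℂ,
    0 ≤ ∑ p ∈ α.support, ∑ q ∈ α.support,
      α p * starRingEnd ℂ (α q) * t (p.1 + q.1) (p.2 + q.2)

/-- The relation that recovers the complex moments `a` from the numbers `s`. -/
def Compatible (a s : ℕ → ℕ → ℂ) : Prop :=
  ∀ m n : ℕ, a m n =
    ∑ r ∈ Finset.range (m + 1), ∑ l ∈ Finset.range (n + 1),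
      (m.choose r : ℂ) * (n.choose l : ℂ) * (-1) ^ (n - l) * Complex.I ^ ((m - r) + (n - l)) *
        s (r + l) ((m - r) + (n - l))

end StripMoment

/-! With x = Re z and y = Im z this is a real moment problem on ℝ × [-R, R], and the numbers s are
the moments of x^m y^n. Necessity: integrate |p|² and (R² - y²)|p|² over the strip, and expand z^m
conj(z)^n in x and y for condition 3.

Sufficiency: the s are real, so they define a linear functional L on ℝ[x, y], nonnegative on squares
and on (R² - y²) times squares. By Haviland's theorem (`exists_measure_of_nonneg`) a measure exists
once L is nonnegative on every q that is nonnegative on the strip. For this q is not itself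
represented by squares; it is replaced by its Bernstein approximations in y, the sums of q(x, y_k)
B_k(y). Each slice q(x, y_k) is nonnegative on the line, hence a sum of two squares
(`exists_eq_sq_add_sq_of_nonneg`). Each B_k is a nonnegative multiple of (R + y)^k (R - y)^(N-k),
and L is nonnegative on such products times squares (`map_sq_mul_pow_mul_pow_nonneg`). The values of
L on the approximations tend to L q (`tendsto_sum_bernstein`), so L q ≥ 0.

The measure on ℝ × [-R, R] is then pushed forward to ℂ, and condition 3 turns its moments back into
the a m n. -/

namespace StripMoment

open MeasureTheory Filter Topology CompactlySupported

/-! ### Haviland's theorem -/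

section Haviland

variable {X : Type*} [TopologicalSpace X] {P : Type*} [CommRing P] [Algebra ℝ P]

/-- A linear functional that is nonnegative on the nonnegative elements of an algebra of continuous
functions extends to the compactly supported functions, with the order preserved. -/
theorem exists_extension_compactlySupported (ev : P →ₐ[ℝ] C(X, ℝ)) (L : P →ₗ[ℝ] ℝ)
    (hL : ∀ p, (∀ x, 0 ≤ ev p x) → 0 ≤ L p) :
    ∃ g : C_c(X, ℝ) →ₗ[ℝ] ℝ, ∀ p f, (∀ x, 0 ≤ ev p x + f x) → 0 ≤ L p + g f := by
  let s : PointedCone ℝ (P × C_c(X, ℝ)) :=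
    { carrier := {z | ∀ x, 0 ≤ ev z.1 x + z.2 x}
      add_mem' := by
        intro a b ha hb x
        have h1 := ha x
        have h2 := hb x
        simp only [Prod.fst_add, Prod.snd_add, map_add, ContinuousMap.add_apply,
          CompactlySupportedContinuousMap.add_apply]
        linarith
      zero_mem' := by
        intro x
        simp
      smul_mem' := by
        rintro ⟨c, hc⟩ a ha x
        have h := mul_nonneg hc (ha x)
        change 0 ≤ ev (c • a.1) x + (c • a.2) x
        simp only [map_smul, ContinuousMap.smul_apply, CompactlySupportedContinuousMap.smul_apply,
          smul_eq_mul]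
        linarith }
  have hs : ∀ z, z ∈ s ↔ ∀ x, 0 ≤ ev z.1 x + z.2 x := fun z => Iff.rfl
  let f : (P × C_c(X, ℝ)) →ₗ.[ℝ] ℝ :=
    ⟨Submodule.prod ⊤ ⊥, L ∘ₗ LinearMap.fst ℝ P C_c(X, ℝ) ∘ₗ Submodule.subtype _⟩
  have hf : ∀ z : f.domain, f z = L (z : P × C_c(X, ℝ)).1 := fun z => rfl
  obtain ⟨g, hg1, hg2⟩ := riesz_extension s f
    (by
      rintro ⟨⟨p, h⟩, hz⟩ hz'
      obtain rfl : h = 0 := by simpa using hz.2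
      rw [hf]
      refine hL p fun x => ?_
      simpa using (hs _).1 hz' x)
    (by
      rintro ⟨p, h⟩
      obtain ⟨C, hC⟩ := h.hasCompactSupport.exists_bound_of_continuous h.continuous
      -- Cofinality of the domain: h is bounded, so a constant of the algebra dominates -h.
      refine ⟨⟨(C • (1 : P) - p, 0), ⟨trivial, rfl⟩⟩, (hs _).2 fun x => ?_⟩
      have := (abs_le.1 (hC x)).1
      simp only [Prod.mk_add_mk, sub_add_cancel, zero_add, map_smul, map_one,
        ContinuousMap.smul_apply, ContinuousMap.one_apply, smul_eq_mul, mul_one]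
      linarith)
  refine ⟨g ∘ₗ LinearMap.inr ℝ P C_c(X, ℝ), fun p h hph => ?_⟩
  have h1 : g (p, 0) = L p := hg1 ⟨(p, 0), ⟨trivial, rfl⟩⟩
  have h2 := hg2 (p, h) ((hs _).2 hph)
  rw [show ((p, h) : P × C_c(X, ℝ)) = (p, 0) + (0, h) by simp, map_add, h1] at h2
  simpa using h2

/-- **Haviland's theorem** for an algebra of continuous functions that contains a proper
nonnegative function. -/
theorem exists_measure_of_nonneg [T2Space X] [LocallyCompactSpace X] [MeasurableSpace X]
    [BorelSpace X] (ev : P →ₐ[ℝ] C(X, ℝ)) (w : P) (hw0 : ∀ x, 0 ≤ ev w x)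
    (hw : ∀ r, IsCompact {x | ev w x ≤ r}) (L : P →ₗ[ℝ] ℝ)
    (hL : ∀ p, (∀ x, 0 ≤ ev p x) → 0 ≤ L p) :
    ∃ μ : Measure X, ∀ p, Integrable (ev p) μ ∧ ∫ x, ev p x ∂μ = L p := by
  obtain ⟨g, hg⟩ := exists_extension_compactlySupported ev L hL
  let Λ : C_c(X, ℝ) →ₚ[ℝ] ℝ := PositiveLinearMap.mk₀ g fun f hf => by
    simpa using hg 0 f (fun x => by simpa using hf x)
  have hΛ : ∀ f, Λ f = g f := fun f => rfl
  let μ := RealRMK.rieszMeasure Λ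
  have hμ : ∀ f : C_c(X, ℝ), ∫ x, f x ∂μ = g f := fun f => by
    rw [← hΛ]; exact RealRMK.integral_rieszMeasure Λ f
  -- A cutoff equal to 1 where w ≤ n and to 0 where w ≥ n + 1; its support is compact because w is
  -- proper.
  let χ : ℕ → C(X, ℝ) := fun n =>
    ⟨fun x => max 0 (min 1 (n + 1 - ev w x)), by fun_prop⟩
  have hχ0 : ∀ n x, 0 ≤ χ n x := fun n x => le_max_left _ _
  have hχ1 : ∀ n x, χ n x ≤ 1 := fun n x => max_le zero_le_one (min_le_left _ _)
  have hχc : ∀ n (p : P), HasCompactSupport (ev p * χ n) := fun n p => by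
    refine HasCompactSupport.intro (hw (n + 1)) fun x hx => ?_
    have : χ n x = 0 := by
      simp only [Set.mem_ofPred_eq, not_le] at hx
      exact max_eq_left ((min_le_right _ _).trans (by linarith))
    simp [this]
  let c : ℕ → P → C_c(X, ℝ) := fun n p => ⟨ev p * χ n, hχc n p⟩
  have hc : ∀ n p x, c n p x = ev p x * χ n x := fun n p x => rfl
  have hχw : ∀ (n : ℕ) x, n * (1 - χ n x) ≤ ev w x := fun n x => by
    rcases le_or_gt (ev w x) n with h | h
    · have : χ n x = 1 := by
        change max 0 (min 1 (n + 1 - ev w x)) = 1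
        rw [min_eq_left (by linarith), max_eq_right zero_le_one]
      rw [this]; simpa using hw0 x
    · have := hχ0 n x
      have hn : (0 : ℝ) ≤ n := n.cast_nonneg
      nlinarith
  have habs : ∀ y : ℝ, |y| ≤ 1 + y ^ 2 := fun y => by
    rw [abs_le]; constructor <;> nlinarith [sq_nonneg (y + 1), sq_nonneg (y - 1)]
  -- The cutoff error of p is at most 1/n times an element of the algebra, on which L is finite;
  -- hence `g (c n p)` tends to `L p`.
  have herr : ∀ (n : ℕ) p x,
      n * |ev p x * (1 - χ n x)| ≤ ev ((1 + p ^ 2) * w) x := fun n p x => by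
    have h1 := hχ1 n x
    rw [abs_mul, abs_of_nonneg (sub_nonneg.2 h1)]
    have h2 := hχw n x
    have h3 := mul_le_mul (habs (ev p x)) h2
      (mul_nonneg n.cast_nonneg (sub_nonneg.2 h1)) (by positivity)
    simp only [map_mul, map_add, map_one, map_pow, ContinuousMap.mul_apply,
      ContinuousMap.add_apply, ContinuousMap.one_apply, ContinuousMap.pow_apply]
    linarith
  have hbound : ∀ (n : ℕ) p, n * |g (c n p) - L p| ≤ L ((1 + p ^ 2) * w) := fun n p => by
    have hn : (0 : ℝ) ≤ n := n.cast_nonneg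
    have h1 := hg ((1 + p ^ 2) * w - (n : ℝ) • p) ((n : ℝ) • c n p) fun x => by
      have h := herr n p x
      have h' := mul_le_mul_of_nonneg_left (le_abs_self (ev p x * (1 - χ n x))) hn
      simp only [map_sub, map_smul, ContinuousMap.sub_apply, ContinuousMap.smul_apply,
        CompactlySupportedContinuousMap.smul_apply, hc, smul_eq_mul]
      linarith
    have h2 := hg ((1 + p ^ 2) * w + (n : ℝ) • p) (-((n : ℝ) • c n p)) fun x => by
      have h := herr n p x
      have h' := mul_le_mul_of_nonneg_left (neg_abs_le (ev p x * (1 - χ n x))) hn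
      simp only [map_add, map_smul, ContinuousMap.add_apply, ContinuousMap.smul_apply,
        CompactlySupportedContinuousMap.neg_apply,
        CompactlySupportedContinuousMap.smul_apply, hc, smul_eq_mul]
      linarith
    simp only [map_sub, map_add, map_neg, map_smul, smul_eq_mul] at h1 h2
    have h3 : (n : ℝ) * |g (c n p) - L p| = |n * (g (c n p) - L p)| := by
      rw [abs_mul, abs_of_nonneg hn]
    rw [h3, abs_le]
    constructor <;> linarith
  have hlim : ∀ p, Tendsto (fun n => g (c n p)) atTop (𝓝 (L p)) := fun p => by
    rw [tendsto_iff_dist_tendsto_zero]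
    refine squeeze_zero' (Eventually.of_forall fun _ => dist_nonneg) ?_
      (tendsto_const_div_atTop_nhds_zero_nat (L ((1 + p ^ 2) * w)))
    filter_upwards [eventually_gt_atTop 0] with n hn
    rw [Real.dist_eq, le_div_iff₀ (by exact_mod_cast hn), mul_comm]
    exact hbound n p
  have hχlim : ∀ x, Tendsto (fun n => χ n x) atTop (𝓝 1) := fun x => by
    refine tendsto_const_nhds.congr' ?_
    obtain ⟨N, hN⟩ := exists_nat_ge (ev w x)
    filter_upwards [eventually_ge_atTop N] with n hn
    have : (N : ℝ) ≤ n := by exact_mod_cast hn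
    change 1 = max 0 (min 1 (n + 1 - ev w x))
    rw [min_eq_left (by linarith), max_eq_right zero_le_one]
  have hclim : ∀ p x, Tendsto (fun n => c n p x) atTop (𝓝 (ev p x)) := fun p x => by
    simpa [hc] using (hχlim x).const_mul (ev p x)
  have hmeas : ∀ p, AEStronglyMeasurable (ev p) μ := fun p =>
    (ev p).continuous.measurable.aestronglyMeasurable
  -- Fatou's lemma gives integrability first; it supplies the dominating function for the limit of
  -- the integrals below.
  have hint_nonneg : ∀ p, (∀ x, 0 ≤ ev p x) → Integrable (ev p) μ := fun p hp => by
    refine ⟨hmeas p, ?_⟩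
    rw [hasFiniteIntegral_iff_ofReal (Eventually.of_forall hp)]
    have hle : ∫⁻ x, ENNReal.ofReal (ev p x) ∂μ ≤ ENNReal.ofReal (L p) := by
      calc ∫⁻ x, ENNReal.ofReal (ev p x) ∂μ
          = ∫⁻ x, liminf (fun n => ENNReal.ofReal (c n p x)) atTop ∂μ := by
            refine lintegral_congr fun x => ?_
            exact (((ENNReal.continuous_ofReal.tendsto _).comp (hclim p x)).liminf_eq).symm
        _ ≤ liminf (fun n => ∫⁻ x, ENNReal.ofReal (c n p x) ∂μ) atTop :=
            lintegral_liminf_le fun n =>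
              ((c n p).continuous.measurable).ennreal_ofReal
        _ = liminf (fun n => ENNReal.ofReal (g (c n p))) atTop := by
            congr 1; ext n
            rw [← hμ, ofReal_integral_eq_lintegral_ofReal]
            · exact (c n p).continuous.integrable_of_hasCompactSupport (c n p).hasCompactSupport
            · exact Eventually.of_forall fun x => mul_nonneg (hp x) (hχ0 n x)
        _ = ENNReal.ofReal (L p) :=
            ((ENNReal.continuous_ofReal.tendsto _).comp (hlim p)).liminf_eq
    exact hle.trans_lt ENNReal.ofReal_lt_top
  have hint : ∀ p, Integrable (ev p) μ := fun p => by
    refine (hint_nonneg (1 + p ^ 2) fun x => ?_).mono' (hmeas p) (Eventually.of_forall fun x => ?_)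
    · simp only [map_add, map_one, map_pow, ContinuousMap.add_apply, ContinuousMap.one_apply,
        ContinuousMap.pow_apply]
      positivity
    · simpa using habs (ev p x)
  refine ⟨μ, fun p => ⟨hint p, ?_⟩⟩
  have h1 : Tendsto (fun n => ∫ x, c n p x ∂μ) atTop (𝓝 (∫ x, ev p x ∂μ)) :=
    tendsto_integral_of_dominated_convergence (fun x => |ev p x|)
      (fun n => (c n p).continuous.measurable.aestronglyMeasurable) (hint p).abs
      (fun n => Eventually.of_forall fun x => by
        rw [hc, Real.norm_eq_abs, abs_mul, abs_of_nonneg (hχ0 n x)]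
        exact mul_le_of_le_one_right (abs_nonneg _) (hχ1 n x))
      (Eventually.of_forall (hclim p))
  simp only [hμ] at h1
  exact tendsto_nhds_unique h1 (hlim p)

end Haviland

end StripMoment

/-! ### Nonnegative polynomials on the line -/

namespace StripMoment

open Polynomial

/-- A real polynomial that is nonnegative on the line is a sum of two squares. -/
theorem exists_eq_sq_add_sq_of_nonneg (q : ℝ[X]) (hq : ∀ x, 0 ≤ q.eval x) :
    ∃ A B : ℝ[X], q = A ^ 2 + B ^ 2 := by
  induction hn : q.natDegree using Nat.strong_induction_on generalizing q with
  | _ n ih =>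
  rcases eq_or_ne n 0 with rfl | hn0
  · obtain ⟨c, rfl⟩ := natDegree_eq_zero.1 hn
    have hc : 0 ≤ c := by simpa using hq 0
    exact ⟨C (Real.sqrt c), 0, by rw [← C_pow, Real.sq_sqrt hc]; simp⟩
  have hq0 : q ≠ 0 := by rintro rfl; simp at hn; omega
  obtain ⟨z, hz⟩ : ∃ z : ℂ, aeval z q = 0 :=
    IsAlgClosed.exists_aeval_eq_zero ℂ q (by
      rw [degree_eq_natDegree hq0, hn]; exact_mod_cast hn0)
  rcases eq_or_ne z.im 0 with hzi | hzi
  · obtain ⟨r, rfl⟩ : ∃ r : ℝ, z = r := ⟨z.re, Complex.ext rfl (by simp [hzi])⟩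
    have hr : q.IsRoot r := by
      have h : ((q.eval r : ℝ) : ℂ) = 0 := by
        rw [← hz]; exact (aeval_algebraMap_apply_eq_algebraMap_eval (A := ℂ) r q).symm
      exact_mod_cast h
    obtain ⟨q₁, rfl⟩ := dvd_iff_isRoot.2 hr
    have hsign : ∀ x, 0 ≤ (x - r) * q₁.eval x := fun x => by simpa using hq x
    -- A real root has even multiplicity: q₁ is ≤ 0 to the left of r and ≥ 0 to the right.
    have hr₁ : q₁.IsRoot r := by
      have hcont : ContinuousAt (fun x => q₁.eval x) r := q₁.continuous.continuousAt
      refine le_antisymm ?_ ?_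
      · refine le_of_tendsto (hcont.tendsto.mono_left (nhdsWithin_le_nhds (s := Set.Iio r))) ?_
        filter_upwards [self_mem_nhdsWithin] with x hx
        have := hsign x
        by_contra! h
        nlinarith [mul_pos (sub_pos.2 (Set.mem_Iio.1 hx)) h]
      · refine ge_of_tendsto (hcont.tendsto.mono_left (nhdsWithin_le_nhds (s := Set.Ioi r))) ?_
        filter_upwards [self_mem_nhdsWithin] with x hx
        have := hsign x
        by_contra! h
        nlinarith [mul_pos (sub_pos.2 (Set.mem_Ioi.1 hx)) (neg_pos.2 h)]
    obtain ⟨q₂, rfl⟩ := dvd_iff_isRoot.2 hr₁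
    have hq₂0 : q₂ ≠ 0 := by rintro rfl; simp at hq0
    have hpos : ∀ x ≠ r, 0 ≤ q₂.eval x := fun x hx => by
      have h := hq x
      simp only [eval_mul, eval_sub, eval_X, eval_C, ← mul_assoc] at h
      exact nonneg_of_mul_nonneg_right h (mul_self_pos.2 (sub_ne_zero.2 hx))
    have hq₂ : ∀ x, 0 ≤ q₂.eval x := fun x => by
      rcases eq_or_ne x r with rfl | hx
      · refine ge_of_tendsto (q₂.continuous.continuousAt.tendsto.mono_left
          (nhdsWithin_le_nhds (s := {x}ᶜ))) ?_
        filter_upwards [self_mem_nhdsWithin] with y hy using hpos y hy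
      · exact hpos x hx
    have hdeg : q₂.natDegree < n := by
      rw [← hn, natDegree_mul (X_sub_C_ne_zero r) (right_ne_zero_of_mul hq0),
        natDegree_mul (X_sub_C_ne_zero r) hq₂0, natDegree_X_sub_C]
      omega
    obtain ⟨A, B, rfl⟩ := ih _ hdeg q₂ hq₂ rfl
    exact ⟨(X - C r) * A, (X - C r) * B, by ring⟩
  · obtain ⟨q₁, rfl⟩ := q.quadratic_dvd_of_aeval_eq_zero_im_ne_zero hz hzi
    have hquad : X ^ 2 - C (2 * z.re) * X + C (‖z‖ ^ 2) =
        (X - C z.re) ^ 2 + (C z.im : ℝ[X]) ^ 2 := by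
      rw [Complex.sq_norm, Complex.normSq_apply]
      simp only [map_mul, map_add, map_ofNat]
      ring
    rw [hquad] at hq hn hq0 ⊢
    have hq₁0 : q₁ ≠ 0 := right_ne_zero_of_mul hq0
    have hq₁ : ∀ x, 0 ≤ q₁.eval x := fun x => by
      have h := hq x
      simp only [eval_mul, eval_add, eval_pow, eval_sub, eval_X, eval_C] at h
      exact nonneg_of_mul_nonneg_right h (by positivity)
    have hdeg : q₁.natDegree < n := by
      rw [← hn, natDegree_mul (left_ne_zero_of_mul hq0) hq₁0, ← hquad]
      have : (X ^ 2 - C (2 * z.re) * X + C (‖z‖ ^ 2)).natDegree = 2 := by compute_degree!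
      omega
    obtain ⟨A, B, rfl⟩ := ih _ hdeg q₁ hq₁ rfl
    -- The two-squares identity, applied to (X - Re z)² + (Im z)² and A² + B².
    exact ⟨(X - C z.re) * A - C z.im * B, (X - C z.re) * B + C z.im * A, by ring⟩

end StripMoment

namespace StripMoment

open Filter Topology

/-! ### Bernstein approximation under a linear functional -/

section Bernstein

open Polynomial

/-- The Bernstein basis polynomials of degree `N` of the interval `[-R, R]`. -/
noncomputable def bernsteinWeight (R : ℝ) (N k : ℕ) : ℝ[X] :=
  C (N.choose k / (2 * R) ^ N) * ((C R + X) ^ k * (C R - X) ^ (N - k))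

/-- The equidistant nodes of the interval `[-R, R]`. -/
noncomputable def bernsteinNode (R : ℝ) (N k : ℕ) : ℝ := R * (2 * k / N - 1)

theorem abs_bernsteinNode_le {R : ℝ} (hR : 0 ≤ R) {N k : ℕ} (hk : k ≤ N) :
    |bernsteinNode R N k| ≤ R := by
  have h0 : (0 : ℝ) ≤ k / N := by positivity
  have h1 : (k : ℝ) / N ≤ 1 := div_le_one_of_le₀ (by exact_mod_cast hk) (by positivity)
  rw [bernsteinNode, abs_mul, abs_of_nonneg hR]
  refine mul_le_of_le_one_right hR (abs_le.2 ?_)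
  rw [mul_div_assoc]
  constructor <;> linarith

theorem sum_bernsteinWeight {R : ℝ} (hR : 0 < R) (N : ℕ) :
    ∑ k ∈ Finset.range (N + 1), bernsteinWeight R N k = 1 := by
  have h : ∀ k, bernsteinWeight R N k =
      C (1 / (2 * R) ^ N) * ((C R + X) ^ k * (C R - X) ^ (N - k) * (N.choose k : ℝ[X])) := by
    intro k
    rw [bernsteinWeight, ← C_eq_natCast,
      show (N.choose k : ℝ) / (2 * R) ^ N = 1 / (2 * R) ^ N * N.choose k by ring, C_mul]
    ring
  simp only [h, ← Finset.mul_sum, ← add_pow]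
  rw [show (C R + X + (C R - X) : ℝ[X]) = C (2 * R) by rw [C_mul, C_ofNat]; ring, ← C_pow,
    ← C_mul, one_div_mul_cancel (by positivity), C_1]

/-- The logarithmic derivative of B_k is k/(R + X) - (N - k)/(R - X), so (R² - X²) B_k' = N (y_k -
X) B_k. Thus multiplying by the node is multiplying by X, up to a term with factor 1/N. -/
theorem bernsteinNode_mul_bernsteinWeight (R : ℝ) {N k : ℕ} (hN : 0 < N) (hk : k ≤ N) :
    C (bernsteinNode R N k) * bernsteinWeight R N k =
      X * bernsteinWeight R N k +
        C (1 / N : ℝ) * ((C R ^ 2 - X ^ 2) * derivative (bernsteinWeight R N k)) := by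
  obtain ⟨l, rfl⟩ := Nat.exists_eq_add_of_le hk
  have hpow : ∀ (u : ℝ[X]) (j : ℕ), (j : ℝ[X]) * u ^ (j - 1) * u = j * u ^ j := by
    intro u j
    rcases j with _ | j
    · simp
    · simp [pow_succ, mul_assoc]
  have hk := hpow (C R + X) k
  have hl := hpow (C R - X) l
  have hN' : ((k : ℝ) + l) ≠ 0 := by exact_mod_cast hN.ne'
  have hNX : C (1 / ((k + l : ℕ) : ℝ)) * ((k : ℝ[X]) + l) = 1 := by
    rw [← C_eq_natCast, ← C_eq_natCast, ← C_add, ← C_mul, ← C_1]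
    push_cast
    rw [one_div_mul_cancel hN']
  have hnode : C (bernsteinNode R (k + l) k) =
      C (1 / ((k + l : ℕ) : ℝ)) * C R * ((k : ℝ[X]) - l) := by
    rw [← C_eq_natCast, ← C_eq_natCast, ← C_sub, ← C_mul, ← C_mul, bernsteinNode]
    congr 1
    push_cast
    field_simp
    ring
  rw [hnode, bernsteinWeight]
  simp only [add_tsub_cancel_left, derivative_mul, derivative_pow,
    derivative_add, derivative_sub, derivative_C, derivative_X, C_eq_natCast]
  generalize C (1 / ((k + l : ℕ) : ℝ)) = c at *
  generalize C (((k + l).choose k : ℝ) / (2 * R) ^ (k + l)) = d at *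
  linear_combination
    (-d * c * (C R - X) ^ l * (C R - X)) * hk + d * c * (C R + X) ^ k * (C R + X) * hl
      + d * X * (C R + X) ^ k * (C R - X) ^ l * hNX

/-- The Bernstein approximations of a monomial converge under each linear functional. -/
theorem tendsto_sum_bernstein {R : ℝ} (hR : 0 < R) (n : ℕ) (M : ℝ[X] →ₗ[ℝ] ℝ) :
    Tendsto (fun N : ℕ => ∑ k ∈ Finset.range (N + 1),
      bernsteinNode R N k ^ n * M (bernsteinWeight R N k)) atTop (𝓝 (M (X ^ n))) := by
  induction n generalizing M with
  | zero =>
    simp only [pow_zero, one_mul, ← map_sum, sum_bernsteinWeight hR]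
    exact tendsto_const_nhds
  | succ n ih =>
    -- The induction runs over all functionals: the factor X and the operator (R² - X²) d/dX are
    -- absorbed into M. The second sum converges, so the factor 1/N kills it.
    have h1 := ih (M ∘ₗ LinearMap.mulLeft ℝ X)
    have h2 := ih (M ∘ₗ LinearMap.mulLeft ℝ (C R ^ 2 - X ^ 2) ∘ₗ derivative)
    have h3 := h1.add (tendsto_one_div_atTop_nhds_zero_nat.mul h2)
    rw [zero_mul, add_zero] at h3
    have hX : (M ∘ₗ LinearMap.mulLeft ℝ X) (X ^ n) = M (X ^ (n + 1)) := by
      simp [pow_succ']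
    rw [hX] at h3
    refine h3.congr' ?_
    filter_upwards [eventually_gt_atTop 0] with N hN
    rw [Finset.mul_sum, ← Finset.sum_add_distrib]
    refine Finset.sum_congr rfl fun k hk => ?_
    have h := congrArg M (bernsteinNode_mul_bernsteinWeight R hN
      (Nat.lt_succ_iff.1 (Finset.mem_range.1 hk)))
    rw [map_add, ← smul_eq_C_mul, ← smul_eq_C_mul, map_smul, map_smul, smul_eq_mul,
      smul_eq_mul] at h
    simp only [LinearMap.comp_apply, LinearMap.mulLeft_apply]
    rw [pow_succ _ n, mul_assoc _ _ (M _), h]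
    ring

end Bernstein

/-! ### Products of R + y and R - y with squares -/

section QuadraticModule

variable {P : Type*} [CommRing P] [Algebra ℝ P]

/-- Since 2R(R ± y) = (R ± y)² + (R² - y²), L is nonnegative on R ± y times a square. The parities
of k and l leave only the factors 1, R - y, R + y and R² - y² beside a square. -/
theorem map_sq_mul_pow_mul_pow_nonneg {R : ℝ} (hR : 0 < R) (y : P) (L : P →ₗ[ℝ] ℝ)
    (h1 : ∀ p, 0 ≤ L (p * p)) (h2 : ∀ p, 0 ≤ L ((algebraMap ℝ P R ^ 2 - y ^ 2) * (p * p)))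
    (p : P) (k l : ℕ) :
    0 ≤ L (p ^ 2 * ((algebraMap ℝ P R + y) ^ k * (algebraMap ℝ P R - y) ^ l)) := by
  have hL : ∀ (c : ℝ) u, L (algebraMap ℝ P c * u) = c * L u := fun c u => by
    rw [← Algebra.smul_def, map_smul, smul_eq_mul]
  have hadd : ∀ u, 0 ≤ L ((algebraMap ℝ P R + y) * (u * u)) := fun u => by
    have h := add_nonneg (h1 ((algebraMap ℝ P R + y) * u)) (h2 u)
    rw [← map_add, show (algebraMap ℝ P R + y) * u * ((algebraMap ℝ P R + y) * u) +
      (algebraMap ℝ P R ^ 2 - y ^ 2) * (u * u) =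
        algebraMap ℝ P (2 * R) * ((algebraMap ℝ P R + y) * (u * u)) by
          rw [map_mul, map_ofNat]; ring, hL] at h
    exact nonneg_of_mul_nonneg_right h (by positivity)
  have hsub : ∀ u, 0 ≤ L ((algebraMap ℝ P R - y) * (u * u)) := fun u => by
    have h := add_nonneg (h1 ((algebraMap ℝ P R - y) * u)) (h2 u)
    rw [← map_add, show (algebraMap ℝ P R - y) * u * ((algebraMap ℝ P R - y) * u) +
      (algebraMap ℝ P R ^ 2 - y ^ 2) * (u * u) =
        algebraMap ℝ P (2 * R) * ((algebraMap ℝ P R - y) * (u * u)) by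
          rw [map_mul, map_ofNat]; ring, hL] at h
    exact nonneg_of_mul_nonneg_right h (by positivity)
  rcases Nat.even_or_odd' k with ⟨i, rfl | rfl⟩ <;> rcases Nat.even_or_odd' l with ⟨j, rfl | rfl⟩
  · convert h1 (p * ((algebraMap ℝ P R + y) ^ i * (algebraMap ℝ P R - y) ^ j)) using 2
    ring
  · convert hsub (p * ((algebraMap ℝ P R + y) ^ i * (algebraMap ℝ P R - y) ^ j)) using 2
    ring
  · convert hadd (p * ((algebraMap ℝ P R + y) ^ i * (algebraMap ℝ P R - y) ^ j)) using 2
    ring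
  · convert h2 (p * ((algebraMap ℝ P R + y) ^ i * (algebraMap ℝ P R - y) ^ j)) using 2
    ring

end QuadraticModule

/-! ### The real moment problem on the strip -/

section Bivariate

open Polynomial (aeval)

/-- Real polynomials in two variables. -/
abbrev Bivariate : Type := AddMonoidAlgebra ℝ (ℕ × ℕ)

variable {A : Type*} [CommRing A] [Algebra ℝ A]

/-- Evaluation of a polynomial in two variables. -/
noncomputable def bivariateEval (x y : A) : Bivariate →ₐ[ℝ] A :=
  AddMonoidAlgebra.lift ℝ A (ℕ × ℕ)
    { toFun := fun p => x ^ (Multiplicative.toAdd p).1 * y ^ (Multiplicative.toAdd p).2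
      map_one' := by simp
      map_mul' := fun p q => by
        simp only [toAdd_mul, Prod.fst_add, Prod.snd_add]
        ring }

theorem bivariateEval_single (x y : A) (m n : ℕ) (c : ℝ) :
    bivariateEval x y (AddMonoidAlgebra.single (m, n) c) = c • (x ^ m * y ^ n) := by
  simp [bivariateEval]

theorem bivariate_induction {motive : Bivariate → Prop} (q : Bivariate)
    (single : ∀ m n c, motive (AddMonoidAlgebra.single (m, n) c))
    (add : ∀ p q, motive p → motive q → motive (p + q)) : motive q := by
  refine AddMonoidAlgebra.induction_linear q ?_ add fun p c => single p.1 p.2 c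
  simpa using single 0 0 0

/-- The functional on polynomials in two variables with prescribed values on the monomials. -/
noncomputable def momentFunctional (t : ℕ → ℕ → ℝ) : Bivariate →ₗ[ℝ] ℝ :=
  Finsupp.linearCombination ℝ (fun p : ℕ × ℕ => t p.1 p.2) ∘ₗ
    (AddMonoidAlgebra.coeffLinearEquiv ℝ).toLinearMap

theorem momentFunctional_single (t : ℕ → ℕ → ℝ) (m n : ℕ) (c : ℝ) :
    momentFunctional t (AddMonoidAlgebra.single (m, n) c) = c * t m n := by
  simp [momentFunctional]

theorem momentFunctional_mul_self (t : ℕ → ℕ → ℝ) (p : Bivariate) :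
    momentFunctional t (p * p) = ∑ i ∈ p.coeff.support, ∑ j ∈ p.coeff.support,
      p.coeff i * p.coeff j * t (i.1 + j.1) (i.2 + j.2) := by
  rw [AddMonoidAlgebra.mul_def]
  simp only [Finsupp.sum, map_sum]
  exact Finset.sum_congr rfl fun i _ => Finset.sum_congr rfl fun j _ =>
    momentFunctional_single t _ _ _

/-- Identifies condition 2 with positivity of L on (R² - y²) times squares. -/
theorem momentFunctional_mul (R : ℝ) (t : ℕ → ℕ → ℝ) (p : Bivariate) :
    momentFunctional t ((algebraMap ℝ Bivariate R ^ 2 - AddMonoidAlgebra.single (0, 1) 1 ^ 2) * p) =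
      momentFunctional (fun m n => R ^ 2 * t m n - t m (n + 2)) p := by
  induction p using bivariate_induction with
  | single m n c =>
    rw [sub_mul, map_sub, ← map_pow, ← Algebra.smul_def, map_smul, AddMonoidAlgebra.single_pow,
      AddMonoidAlgebra.single_mul_single]
    simp only [momentFunctional_single, Prod.smul_mk, Prod.mk_add_mk, smul_eq_mul]
    rw [show 2 * 0 + m = m by ring, show 2 * 1 + n = n + 2 by ring]
    ring
  | add p q hp hq => rw [mul_add, map_add, map_add, hp, hq]

/-- The Bernstein approximations in the second variable converge under each linear functional. -/
theorem tendsto_sum_bernstein_bivariate {R : ℝ} (hR : 0 < R) (L : Bivariate →ₗ[ℝ] ℝ)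
    (q : Bivariate) :
    Tendsto (fun N : ℕ => ∑ k ∈ Finset.range (N + 1),
      L (aeval (AddMonoidAlgebra.single (1, 0) 1 : Bivariate)
          (bivariateEval Polynomial.X (Polynomial.C (bernsteinNode R N k)) q) *
        aeval (AddMonoidAlgebra.single (0, 1) 1 : Bivariate) (bernsteinWeight R N k)))
      atTop (𝓝 (L q)) := by
  induction q using bivariate_induction with
  | single m n c =>
    -- The factor x^m is absorbed into the functional, which leaves the one-variable statement for
    -- y^n.
    have h := (tendsto_sum_bernstein hR n (L ∘ₗ
      LinearMap.mulLeft ℝ ((AddMonoidAlgebra.single (1, 0) 1 : Bivariate) ^ m) ∘ₗ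
      (aeval (AddMonoidAlgebra.single (0, 1) 1 : Bivariate)).toLinearMap)).const_mul c
    have hsingle : (AddMonoidAlgebra.single (m, n) c : Bivariate) =
        c • (AddMonoidAlgebra.single (1, 0) 1 ^ m * AddMonoidAlgebra.single (0, 1) 1 ^ n) := by
      simp [AddMonoidAlgebra.single_pow, AddMonoidAlgebra.single_mul_single]
    rw [hsingle]
    simp only [LinearMap.comp_apply, LinearMap.mulLeft_apply, AlgHom.toLinearMap_apply, map_pow,
      Polynomial.aeval_X, Finset.mul_sum] at h
    rw [map_smul, smul_eq_mul]
    refine h.congr fun N => Finset.sum_congr rfl fun k _ => ?_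
    rw [← hsingle, bivariateEval_single, ← Polynomial.C_pow, mul_comm (Polynomial.X ^ m),
      ← Polynomial.smul_eq_C_mul]
    simp only [map_smul, map_pow, Polynomial.aeval_X, smul_mul_assoc, smul_eq_mul]
  | add p q hp hq =>
    simpa only [map_add, add_mul, Finset.sum_add_distrib] using hp.add hq

/-- The polynomials in two variables as continuous functions on the strip. -/
noncomputable def stripEval (R : ℝ) : Bivariate →ₐ[ℝ] C(ℝ × Set.Icc (-R) R, ℝ) :=
  bivariateEval ⟨fun z => z.1, by fun_prop⟩ ⟨fun z => z.2, by fun_prop⟩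

theorem stripEval_single (R : ℝ) (m n : ℕ) (c : ℝ) (z : ℝ × Set.Icc (-R) R) :
    stripEval R (AddMonoidAlgebra.single (m, n) c) z = c * (z.1 ^ m * (z.2 : ℝ) ^ n) := by
  simp [stripEval, bivariateEval_single]

theorem eval_bivariateEval (R : ℝ) (q : Bivariate) (t : ℝ) (c : Set.Icc (-R) R) :
    (bivariateEval Polynomial.X (Polynomial.C (c : ℝ)) q).eval t = stripEval R q (t, c) := by
  induction q using bivariate_induction with
  | single m n a => rw [stripEval_single, bivariateEval_single]; simp
  | add p q hp hq => simp only [map_add, Polynomial.eval_add, hp, hq, ContinuousMap.add_apply]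

/-- A functional that is nonnegative on squares and on `(R² - y²)` times squares is nonnegative on
the polynomials that are nonnegative on the strip. -/
theorem nonneg_of_stripEval_nonneg {R : ℝ} (hR : 0 < R) (L : Bivariate →ₗ[ℝ] ℝ)
    (h1 : ∀ p, 0 ≤ L (p * p))
    (h2 : ∀ p, 0 ≤ L ((algebraMap ℝ Bivariate R ^ 2 - AddMonoidAlgebra.single (0, 1) 1 ^ 2) *
      (p * p)))
    (q : Bivariate) (hq : ∀ z, 0 ≤ stripEval R q z) : 0 ≤ L q := by
  refine ge_of_tendsto' (tendsto_sum_bernstein_bivariate hR L q) fun N =>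
    Finset.sum_nonneg fun k hk => ?_
  have hk' : k ≤ N := Nat.lt_succ_iff.1 (Finset.mem_range.1 hk)
  obtain ⟨A, B, hAB⟩ := exists_eq_sq_add_sq_of_nonneg
    (bivariateEval Polynomial.X (Polynomial.C (bernsteinNode R N k)) q) fun t => by
      rw [eval_bivariateEval R q t ⟨_, abs_le.1 (abs_bernsteinNode_le hR.le hk')⟩]
      exact hq _
  rw [hAB, bernsteinWeight]
  simp only [map_add, map_mul, map_pow, map_sub, Polynomial.aeval_X, Polynomial.aeval_C, add_mul]
  simp only [← Algebra.smul_def, mul_smul_comm, map_smul, smul_eq_mul]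
  have hc : (0 : ℝ) ≤ N.choose k / (2 * R) ^ N := by positivity
  exact add_nonneg
    (mul_nonneg hc (map_sq_mul_pow_mul_pow_nonneg hR _ L h1 h2 _ _ _))
    (mul_nonneg hc (map_sq_mul_pow_mul_pow_nonneg hR _ L h1 h2 _ _ _))

/-- The real moment problem in the strip. -/
theorem exists_measure_of_momentFunctional {R : ℝ} (hR : 0 < R) (t : ℕ → ℕ → ℝ)
    (h1 : ∀ p, 0 ≤ momentFunctional t (p * p))
    (h2 : ∀ p, 0 ≤ momentFunctional (fun m n => R ^ 2 * t m n - t m (n + 2)) (p * p)) :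
    ∃ μ : MeasureTheory.Measure (ℝ × Set.Icc (-R) R), ∀ m n : ℕ,
      MeasureTheory.Integrable (fun z => z.1 ^ m * (z.2 : ℝ) ^ n) μ ∧
        ∫ z, z.1 ^ m * (z.2 : ℝ) ^ n ∂μ = t m n := by
  -- The proper function is x²: the y-range is already compact.
  obtain ⟨μ, hμ⟩ := exists_measure_of_nonneg (stripEval R) (AddMonoidAlgebra.single (2, 0) 1)
    (fun z => by rw [stripEval_single]; simp; positivity)
    (fun r => by
      refine ((isCompact_Icc (a := -(1 + |r|)) (b := 1 + |r|)).prod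
        (isCompact_univ (X := Set.Icc (-R) R))).of_isClosed_subset
        (isClosed_le (ContinuousMap.continuous _) continuous_const) ?_
      intro z hz
      simp only [Set.mem_ofPred_eq, stripEval_single, one_mul, pow_zero, mul_one] at hz
      refine ⟨abs_le.1 ?_, trivial⟩
      refine abs_le_of_sq_le_sq ?_ (by positivity)
      nlinarith [le_abs_self r, abs_nonneg r])
    (momentFunctional t) (nonneg_of_stripEval_nonneg hR _ h1 fun p => by
      rw [momentFunctional_mul]; exact h2 p)
  refine ⟨μ, fun m n => ?_⟩
  have h := hμ (AddMonoidAlgebra.single (m, n) 1)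
  rw [momentFunctional_single, one_mul] at h
  have hfun : ⇑(stripEval R (AddMonoidAlgebra.single (m, n) 1)) =
      fun z => z.1 ^ m * (z.2 : ℝ) ^ n := funext fun z => by rw [stripEval_single, one_mul]
  rwa [hfun] at h

end Bivariate

end StripMoment

namespace StripMoment

open MeasureTheory

/-! ### Positive definite kernels and functionals -/

section Kernel

theorem PosKernel.sum_nonneg {t : ℕ → ℕ → ℂ} (h : PosKernel t) (α : ℕ × ℕ →₀ ℂ) :
    0 ≤ α.sum fun p a => α.sum fun q b =>
      a * starRingEnd ℂ b * t (p.1 + q.1) (p.2 + q.2) := h α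

/-- Test with δ_(m,n) + δ_(0,0): the diagonal terms are real and both cross terms equal t m n, so 2
t m n is real. -/
theorem PosKernel.im_eq_zero {t : ℕ → ℕ → ℂ} (h : PosKernel t) (m n : ℕ) : (t m n).im = 0 := by
  have hdiag : ∀ p : ℕ × ℕ, (t (p.1 + p.1) (p.2 + p.2)).im = 0 := fun p => by
    have := h.sum_nonneg (Finsupp.single p 1)
    simpa using (Complex.nonneg_iff.1 this).2.symm
  have h2 := h.sum_nonneg (Finsupp.single (m, n) 1 + Finsupp.single (0, 0) 1)
  rw [Finsupp.sum_add_index' (by simp)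
    (fun p b₁ b₂ => by simp [Finsupp.sum, add_mul, Finset.sum_add_distrib])] at h2
  rw [Finsupp.sum_single_index (by simp), Finsupp.sum_single_index (by simp),
    Finsupp.sum_add_index' (by simp) (by simp [mul_add, add_mul]),
    Finsupp.sum_add_index' (by simp) (by simp [mul_add, add_mul]),
    Finsupp.sum_single_index (by simp), Finsupp.sum_single_index (by simp),
    Finsupp.sum_single_index (by simp), Finsupp.sum_single_index (by simp)] at h2
  have h3 := (Complex.nonneg_iff.1 h2).2
  have h4 := hdiag (m, n)
  have h5 := hdiag (0, 0)
  simp only [map_one, one_mul, mul_one, Complex.add_im, zero_add, add_zero] at h3 h4 h5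
  linarith

theorem PosKernel.ofReal_re {t : ℕ → ℕ → ℂ} (h : PosKernel t) (m n : ℕ) :
    ((t m n).re : ℂ) = t m n :=
  Complex.ext rfl (by simp [h.im_eq_zero m n])

theorem PosKernel.momentFunctional_nonneg {t : ℕ → ℕ → ℂ} (h : PosKernel t) (p : Bivariate) :
    0 ≤ momentFunctional (fun m n => (t m n).re) (p * p) := by
  have h1 := h (p.coeff.mapRange Complex.ofReal Complex.ofReal_zero)
  rw [Finsupp.support_mapRange_of_injective _ _ Complex.ofReal_injective] at h1
  rw [momentFunctional_mul_self, ← Complex.zero_le_real]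
  convert h1 using 1
  push_cast
  refine Finset.sum_congr rfl fun i _ => Finset.sum_congr rfl fun j _ => ?_
  rw [h.ofReal_re]
  simp

/-- The moments of a nonnegative density form a positive definite kernel. -/
theorem posKernel_of_integral (ν : Measure ℂ) (ρ : ℂ → ℝ) (hρ : ∀ᵐ z ∂ν, 0 ≤ ρ z)
    (t : ℕ → ℕ → ℂ)
    (hint : ∀ m n : ℕ, Integrable (fun z : ℂ => (z.re : ℂ) ^ m * (z.im : ℂ) ^ n * ρ z) ν)
    (ht : ∀ m n : ℕ, ∫ z : ℂ, (z.re : ℂ) ^ m * (z.im : ℂ) ^ n * ρ z ∂ν = t m n) :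
    PosKernel t := by
  intro α
  have hsum : ∑ p ∈ α.support, ∑ q ∈ α.support,
      α p * starRingEnd ℂ (α q) * t (p.1 + q.1) (p.2 + q.2) =
      ∫ z : ℂ, ∑ p ∈ α.support, ∑ q ∈ α.support, α p * starRingEnd ℂ (α q) *
        ((z.re : ℂ) ^ (p.1 + q.1) * (z.im : ℂ) ^ (p.2 + q.2) * ρ z) ∂ν := by
    rw [integral_finsetSum _ fun p _ => integrable_finsetSum _ fun q _ => (hint _ _).const_mul _]
    refine Finset.sum_congr rfl fun p _ => ?_
    rw [integral_finsetSum _ fun q _ => (hint _ _).const_mul _]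
    refine Finset.sum_congr rfl fun q _ => ?_
    rw [integral_const_mul, ht]
  have hsq : ∀ z : ℂ, ∑ p ∈ α.support, ∑ q ∈ α.support, α p * starRingEnd ℂ (α q) *
        ((z.re : ℂ) ^ (p.1 + q.1) * (z.im : ℂ) ^ (p.2 + q.2) * ρ z) =
      ((ρ z * Complex.normSq (∑ p ∈ α.support, α p * ((z.re : ℂ) ^ p.1 * (z.im : ℂ) ^ p.2)) :
        ℝ) : ℂ) := by
    intro z
    rw [Complex.ofReal_mul, ← Complex.mul_conj, map_sum, Finset.sum_mul_sum, Finset.mul_sum]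
    refine Finset.sum_congr rfl fun p _ => ?_
    rw [Finset.mul_sum]
    refine Finset.sum_congr rfl fun q _ => ?_
    simp only [map_mul, map_pow, Complex.conj_ofReal]
    ring
  rw [hsum]
  simp only [hsq]
  rw [integral_complex_ofReal, Complex.zero_le_real]
  refine integral_nonneg_of_ae ?_
  filter_upwards [hρ] with z hz using mul_nonneg hz (Complex.normSq_nonneg _)

end Kernel

/-! ### Passing between z, conj z and x, y -/

section Change

theorem re_pow_mul_im_pow (z : ℂ) (m n : ℕ) :
    (z.re : ℂ) ^ m * (z.im : ℂ) ^ n = 1 / (2 ^ m * (2 * Complex.I) ^ n) *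
      ∑ k ∈ Finset.range (m + 1), ∑ j ∈ Finset.range (n + 1),
        (-1) ^ (n - j) * (m.choose k : ℂ) * (n.choose j : ℂ) *
          (z ^ (k + j) * (starRingEnd ℂ z) ^ ((m - k) + (n - j))) := by
  have hsub : (2 * Complex.I) * (z.im : ℂ) = z + -(starRingEnd ℂ z) := by
    rw [← sub_eq_add_neg, Complex.sub_conj]; push_cast; ring
  have hadd : 2 * (z.re : ℂ) = z + starRingEnd ℂ z := by
    rw [Complex.add_conj]; push_cast; ring
  have h : (2 ^ m * (2 * Complex.I) ^ n) * ((z.re : ℂ) ^ m * (z.im : ℂ) ^ n) =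
      (z + starRingEnd ℂ z) ^ m * (z + -(starRingEnd ℂ z)) ^ n := by
    rw [← hsub, ← hadd]; ring
  have h0 : (2 : ℂ) ^ m * (2 * Complex.I) ^ n ≠ 0 := by simp
  rw [one_div, eq_inv_mul_iff_mul_eq₀ h0, h, add_pow, add_pow, Finset.sum_mul_sum]
  refine Finset.sum_congr rfl fun k _ => Finset.sum_congr rfl fun j _ => ?_
  rw [neg_pow (starRingEnd ℂ z)]
  ring

theorem pow_mul_conj_pow (z : ℂ) (m n : ℕ) :
    z ^ m * (starRingEnd ℂ z) ^ n =
      ∑ r ∈ Finset.range (m + 1), ∑ l ∈ Finset.range (n + 1),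
        (m.choose r : ℂ) * (n.choose l : ℂ) * (-1) ^ (n - l) * Complex.I ^ ((m - r) + (n - l)) *
          ((z.re : ℂ) ^ (r + l) * (z.im : ℂ) ^ ((m - r) + (n - l))) := by
  have h1 : z = z.re + z.im * Complex.I := (Complex.re_add_im z).symm
  have h2 : starRingEnd ℂ z = z.re + -(z.im * Complex.I) := by
    apply Complex.ext <;> simp
  rw [h2]
  nth_rw 1 [h1]
  rw [add_pow, add_pow, Finset.sum_mul_sum]
  refine Finset.sum_congr rfl fun k _ => Finset.sum_congr rfl fun j _ => ?_
  rw [neg_pow (z.im * Complex.I : ℂ)]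
  ring

variable {ν : Measure ℂ}

theorem realMoment_of_integral {a : ℕ → ℕ → ℂ}
    (hint : ∀ m n : ℕ, Integrable (fun z : ℂ => z ^ m * (starRingEnd ℂ z) ^ n) ν)
    (ha : ∀ m n : ℕ, ∫ z : ℂ, z ^ m * (starRingEnd ℂ z) ^ n ∂ν = a m n) (m n : ℕ) :
    Integrable (fun z : ℂ => (z.re : ℂ) ^ m * (z.im : ℂ) ^ n) ν ∧
      ∫ z : ℂ, (z.re : ℂ) ^ m * (z.im : ℂ) ^ n ∂ν = realMoment a m n := by
  simp only [re_pow_mul_im_pow]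
  refine ⟨(integrable_finsetSum _ fun p _ => integrable_finsetSum _ fun q _ =>
    (hint _ _).const_mul _).const_mul _, ?_⟩
  rw [integral_const_mul, realMoment,
    integral_finsetSum _ fun p _ => integrable_finsetSum _ fun q _ => (hint _ _).const_mul _]
  congr 1
  refine Finset.sum_congr rfl fun p _ => ?_
  rw [integral_finsetSum _ fun q _ => (hint _ _).const_mul _]
  refine Finset.sum_congr rfl fun q _ => ?_
  rw [integral_const_mul, ha]

theorem complexMoment_of_integral {s : ℕ → ℕ → ℂ}
    (hint : ∀ m n : ℕ, Integrable (fun z : ℂ => (z.re : ℂ) ^ m * (z.im : ℂ) ^ n) ν)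
    (hs : ∀ m n : ℕ, ∫ z : ℂ, (z.re : ℂ) ^ m * (z.im : ℂ) ^ n ∂ν = s m n) (m n : ℕ) :
    Integrable (fun z : ℂ => z ^ m * (starRingEnd ℂ z) ^ n) ν ∧
      ∫ z : ℂ, z ^ m * (starRingEnd ℂ z) ^ n ∂ν =
        ∑ r ∈ Finset.range (m + 1), ∑ l ∈ Finset.range (n + 1),
          (m.choose r : ℂ) * (n.choose l : ℂ) * (-1) ^ (n - l) *
            Complex.I ^ ((m - r) + (n - l)) * s (r + l) ((m - r) + (n - l)) := by
  simp only [pow_mul_conj_pow]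
  refine ⟨integrable_finsetSum _ fun p _ => integrable_finsetSum _ fun q _ =>
    (hint _ _).const_mul _, ?_⟩
  rw [integral_finsetSum _ fun p _ => integrable_finsetSum _ fun q _ => (hint _ _).const_mul _]
  refine Finset.sum_congr rfl fun p _ => ?_
  rw [integral_finsetSum _ fun q _ => (hint _ _).const_mul _]
  refine Finset.sum_congr rfl fun q _ => ?_
  rw [integral_const_mul, hs]

end Change

/-! ### The two implications -/

theorem measurableSet_strip (R : ℝ) : MeasurableSet (strip R) :=
  (isClosed_le (by fun_prop) continuous_const).measurableSet

theorem Solvable.conditions {R : ℝ} {a : ℕ → ℕ → ℂ} (h : Solvable R a) :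
    PosKernel (realMoment a) ∧
      PosKernel (fun m n => (R : ℂ) ^ 2 * realMoment a m n - realMoment a m (n + 2)) ∧
      Compatible a (realMoment a) := by
  obtain ⟨σ, -, hint, hmom⟩ := h
  have hs := realMoment_of_integral hint hmom
  refine ⟨?_, ?_, fun m n => ?_⟩
  · refine posKernel_of_integral (σ.restrict (strip R)) (fun _ => 1) (by simp) _ ?_ ?_
    · simpa using fun m n => (hs m n).1
    · simpa using fun m n => (hs m n).2
  · have hz : ∀ m n (z : ℂ), (z.re : ℂ) ^ m * (z.im : ℂ) ^ n * ((R ^ 2 - z.im ^ 2 : ℝ) : ℂ) =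
        (R : ℂ) ^ 2 * ((z.re : ℂ) ^ m * (z.im : ℂ) ^ n) -
          (z.re : ℂ) ^ m * (z.im : ℂ) ^ (n + 2) := by
      intro m n z; push_cast; ring
    refine posKernel_of_integral (σ.restrict (strip R)) (fun z => R ^ 2 - z.im ^ 2) ?_ _ ?_ ?_
    · filter_upwards [ae_restrict_mem (measurableSet_strip R)] with z hz
      exact sub_nonneg.2 (sq_le_sq.2 (le_trans hz (le_abs_self R)))
    · intro m n
      simp only [hz]
      exact ((hs m n).1.const_mul _).sub (hs m (n + 2)).1
    · intro m n
      simp only [hz]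
      rw [integral_sub ((hs m n).1.const_mul _) (hs m (n + 2)).1, integral_const_mul,
        (hs m n).2, (hs m (n + 2)).2]
  · rw [← hmom m n]
    exact (complexMoment_of_integral (fun m n => (hs m n).1) (fun m n => (hs m n).2) m n).2

theorem solvable_of_conditions {R : ℝ} (hR : 0 < R) {a : ℕ → ℕ → ℂ}
    (h1 : PosKernel (realMoment a))
    (h2 : PosKernel (fun m n => (R : ℂ) ^ 2 * realMoment a m n - realMoment a m (n + 2)))
    (h3 : Compatible a (realMoment a)) : Solvable R a := by
  obtain ⟨μ, hμ⟩ := exists_measure_of_momentFunctional hR (fun m n => (realMoment a m n).re)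
    h1.momentFunctional_nonneg (fun p => by
      have h := h2.momentFunctional_nonneg p
      simpa only [Complex.sub_re, ← Complex.ofReal_pow, Complex.re_ofReal_mul] using h)
  let φ : ℝ × Set.Icc (-R) R → ℂ := fun z => z.1 + (z.2 : ℝ) * Complex.I
  have hφc : Continuous φ := by fun_prop
  have hφ : Measurable φ := hφc.measurable
  have hφre : ∀ z, (φ z).re = z.1 := fun z => by simp [φ]
  have hφim : ∀ z, (φ z).im = z.2 := fun z => by simp [φ]
  have hcarried : (μ.map φ) (strip R)ᶜ = 0 := by
    rw [Measure.map_apply hφ (measurableSet_strip R).compl]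
    convert measure_empty (μ := μ)
    rw [Set.preimage_compl, Set.compl_empty_iff, Set.eq_univ_iff_forall]
    intro z
    change |(φ z).im| ≤ R
    rw [hφim]
    exact abs_le.2 z.2.2
  have hmeas : ∀ m n : ℕ, AEStronglyMeasurable
      (fun z : ℂ => (z.re : ℂ) ^ m * (z.im : ℂ) ^ n) (μ.map φ) := fun m n =>
    Continuous.aestronglyMeasurable (by fun_prop)
  have hcoe : ∀ (m n : ℕ) z, ((φ z).re : ℂ) ^ m * ((φ z).im : ℂ) ^ n =
      ((z.1 ^ m * (z.2 : ℝ) ^ n : ℝ) : ℂ) := fun m n z => by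
    rw [hφre, hφim]; push_cast; rfl
  have hs : ∀ m n : ℕ,
      Integrable (fun z : ℂ => (z.re : ℂ) ^ m * (z.im : ℂ) ^ n) (μ.map φ) ∧
        ∫ z : ℂ, (z.re : ℂ) ^ m * (z.im : ℂ) ^ n ∂(μ.map φ) = realMoment a m n := by
    intro m n
    constructor
    · rw [integrable_map_measure (hmeas m n) hφ.aemeasurable]
      exact (hμ m n).1.ofReal.congr (Filter.Eventually.of_forall fun z => (hcoe m n z).symm)
    · rw [integral_map hφ.aemeasurable (hmeas m n)]
      simp only [hcoe]
      rw [integral_complex_ofReal, (hμ m n).2]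
      exact h1.ofReal_re m n
  have ha := complexMoment_of_integral (fun m n => (hs m n).1) (fun m n => (hs m n).2)
  refine ⟨μ.map φ, hcarried, fun m n => (ha m n).1.integrableOn, fun m n => ?_⟩
  have hmem : ∀ᵐ z ∂μ.map φ, z ∈ strip R := mem_ae_iff.2 hcarried
  rw [Measure.restrict_eq_self_of_ae_mem hmem, (ha m n).2]
  exact (h3 m n).symm

end StripMoment

theorem theorem4p1 (R : ℝ) (hR : 0 < R) (a : ℕ → ℕ → ℂ) :
    StripMoment.Solvable R a ↔
      StripMoment.PosKernel (StripMoment.realMoment a) ∧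
      StripMoment.PosKernel (fun m n =>
        (R : ℂ) ^ 2 * StripMoment.realMoment a m n - StripMoment.realMoment a m (n + 2)) ∧
      StripMoment.Compatible a (StripMoment.realMoment a) :=
  ⟨fun h => h.conditions, fun ⟨h1, h2, h3⟩ => StripMoment.solvable_of_conditions hR h1 h2 h3⟩
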